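/- For a prime $p$ and a positive integer $d$ let $\pounds_d(x)=\sum_{k=1}^{p-1}x^k/k^d$ and $Q_p(x)=\bigl(x^p+(1-x)^p-1\bigr)/p$. Let $\phi_{\pm}=(1\pm\sqrt5)/2$, let $L_n$ be the Lucas numbers ($L_0=2$, $L_1=1$, $L_{n+2}=L_{n+1}+L_n$), let $B_n$ be the Bernoulli numbers and $\left(\frac{p}{5}\right)$ the Legendre symbol. Congruences modulo $p$ are taken in the ring of $p$-integral elements of $\mathbb Q(\sqrt5)$ (quotients of an algebraic integer by a rational integer prime to $p$). **Theorem.** For every prime $p>5$, with $q_L=(L_p-1)/p$ (the Lucas quotient), one has $Q_p(\phi_{\pm})=q_L$ and $$\pounds_2(\phi_{\pm})\equiv \mp\frac{\sqrt5}{10}\left(\frac{p}{5}\right)q_L^2 \pmod p,$$ $$\pounds_2(\phi_{\pm}^2)\equiv -\frac12\left(1\pm\frac{\sqrt5}{5}\left(\frac{p}{5}\right)\right)q_L^2 \pmod p,$$ $$\pounds_2(-\phi_{\pm})\equiv -\frac14\left(1\pm\frac{\sqrt5}{5}\left(\frac{p}{5}\right)\right)q_L^2 \pmod p,$$ $$\pounds_3(\phi_{\pm}^2)\equiv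 -\frac{2}{15}\left(1\pm\sqrt5\left(\frac{p}{5}\right)\right)\left(\frac12 q_L^3+B_{p-3}\right) \pmod p,$$ where in each line the upper signs, or the lower signs, are taken throughout. -/

import Mathlib

namespace FinitePolylog

/-- The finite polylogarithm `£_d(x) = ∑_{k=1}^{p-1} x^k / k^d` (for the prime `p`). -/
noncomputable def finPolylog (p d : ℕ) (x : ℝ) : ℝ :=
  ∑ k ∈ Finset.Icc 1 (p - 1), x ^ k / (k : ℝ) ^ d

/-- `Q_p(x) = (x^p + (1 - x)^p - 1) / p`. -/
noncomputable def bigQ (p : ℕ) (x : ℝ) : ℝ :=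
  (x ^ p + (1 - x) ^ p - 1) / (p : ℝ)

/-- The Lucas numbers `L_0 = 2`, `L_1 = 1`, `L_{n+2} = L_{n+1} + L_n`. -/
def lucasNumber : ℕ → ℤ
  | 0 => 2
  | 1 => 1
  | n + 2 => lucasNumber (n + 1) + lucasNumber n

/-- The Lucas quotient `q_L = (L_p - 1) / p`, as a real number (no rounding takes place). -/
noncomputable def lucasQuotient (p : ℕ) : ℝ :=
  ((lucasNumber p : ℝ) - 1) / (p : ℝ)

/-- `φ_ε = (1 + ε √5) / 2`, so that `φ_+` and `φ_-` are the values at `ε = 1` and `ε = -1`. -/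
noncomputable def phi (ε : ℝ) : ℝ :=
  (1 + ε * √5) / 2

/-- A number is `p`-integral if it has the form `a / n` with `a` an algebraic integer and `n` a
rational integer not divisible by `p`; equivalently, it is integral over `ℤ_(p)`. -/
def IsPIntegral (p : ℕ) (z : ℝ) : Prop :=
  ∃ n : ℤ, ¬ (p : ℤ) ∣ n ∧ IsIntegral ℤ ((n : ℝ) * z)

/-- The congruence `x ≡ y (mod p)`: the difference is `p` times a `p`-integral number. For `x`, `y`
in `ℚ(√5)` this is congruence modulo the ideal `p R`, where `R` is the ring of `p`-integral elements
of `ℚ(√5)`. -/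
def ModEqP (p : ℕ) (x y : ℝ) : Prop :=
  ∃ z : ℝ, IsPIntegral p z ∧ x - y = (p : ℝ) * z

instance factPrimeFive : Fact (Nat.Prime 5) := ⟨Nat.prime_five⟩

/-- The Legendre symbol `(p / 5)`, as a real number. -/
noncomputable def leg5 (p : ℕ) : ℝ :=
  ((legendreSym 5 (p : ℤ) : ℤ) : ℝ)

end FinitePolylog

namespace FinitePolylog

open Polynomial

/-! ### Power sums over the nonzero residues modulo `p`. -/

section PowerSums

variable {p : ℕ} [Fact p.Prime]

/-! Modulo `p` the finite polylogarithms are polynomials over `ZMod p` with `X · £_{d+1}' = £_d` and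
`(1 - X) £_0 = X - X^p`. Since `X^p` has derivative zero, the classical functional equations have
finite analogues in which `X^p` plays the role of a constant. A candidate identity is
differentiated, the result reduces to identities of lower weight, and a polynomial with zero
derivative and small degree is a short polynomial in `X^p`, fixed by its values at `0` and `1`. This
gives `polylogPoly_two_reflection`, `polylogPoly_two_landen` and `polylogPoly_three_landen`; the
last retains one undetermined constant, the coefficient of `X^p` in `£_1^3`.

If `φ² = φ + 1`, then `1 - φ = -1/φ` and `1 - 1/φ = 1/φ²`. Up to inversion, all arguments in these
equations therefore lie among `φ`, `-φ`, `φ²`. Together with the distribution relation they form a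
linear system over `f = φ^p`, itself a root of `x² = x + 1`. Solving it expresses the required
values through `£_1(φ)` (`aeval_polylogPoly_two_golden`, `aeval_polylogPoly_three_golden`).

Three translations finish the proof. Dividing binomial coefficients by `p` gives `Q_p(x) ≡ -£_1(x)`,
and Binet's formula gives `Q_p(φ) = q_L`. Frobenius and Euler's criterion give `2f = 1 ± √5 (p/5)`.
The leftover constant is `-2 ∑ H_{n-1}/n²`, which Faulhaber's formula turns into `-2 B_{p-3}`
(`reducesTo_bernoulli`). -/

lemma natCast_ne_zero_of_mem_Icc {k : ℕ} (hk : k ∈ Finset.Icc 1 (p - 1)) : (k : ZMod p) ≠ 0 := by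
  have := (Fact.out : p.Prime).two_le
  rw [Finset.mem_Icc] at hk
  rw [Ne, ZMod.natCast_eq_zero_iff]
  intro h
  have := Nat.le_of_dvd (by omega) h
  omega

/-- A sum over `1, …, p - 1` is a sum over the units of `ZMod p`. -/
lemma sum_Icc_eq_sum_units {M : Type*} [AddCommMonoid M] (g : ZMod p → M) :
    ∑ k ∈ Finset.Icc 1 (p - 1), g k = ∑ u : (ZMod p)ˣ, g u := by
  symm
  refine Finset.sum_bij (fun u _ => (u : ZMod p).val) ?_ ?_ ?_ ?_
  · intro u _
    have h1 := ZMod.val_lt (u : ZMod p)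
    have h2 : (u : ZMod p).val ≠ 0 := by
      rw [Ne, ZMod.val_eq_zero]; exact u.ne_zero
    rw [Finset.mem_Icc]; omega
  · intro u _ v _ h
    exact Units.ext (ZMod.val_injective p h)
  · intro k hk
    refine ⟨Units.mk0 (k : ZMod p) (natCast_ne_zero_of_mem_Icc hk), Finset.mem_univ _, ?_⟩
    have := (Fact.out : p.Prime).two_le
    rw [Finset.mem_Icc] at hk
    rw [Units.val_mk0, ZMod.val_natCast_of_lt (by omega)]
  · intro u _
    rw [ZMod.natCast_zmod_val]

lemma sum_natCast_pow (m : ℕ) :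
    ∑ k ∈ Finset.Icc 1 (p - 1), (k : ZMod p) ^ m = if p - 1 ∣ m then -1 else 0 := by
  rw [sum_Icc_eq_sum_units (fun x : ZMod p => x ^ m)]
  have h := FiniteField.sum_pow_units (ZMod p) m
  rw [ZMod.card] at h
  exact h

lemma sum_natCast_inv_pow {d : ℕ} (hd : 0 < d) (hdp : d < p - 1) :
    ∑ k ∈ Finset.Icc 1 (p - 1), ((k : ZMod p)⁻¹) ^ d = 0 := by
  rw [sum_Icc_eq_sum_units (fun x : ZMod p => x⁻¹ ^ d),
    ← Equiv.sum_comp (Equiv.inv (ZMod p)ˣ)]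
  have h := FiniteField.sum_pow_units (ZMod p) d
  rw [ZMod.card, if_neg (fun h => by have := Nat.le_of_dvd hd h; omega)] at h
  rw [← h]
  refine Finset.sum_congr rfl fun u _ => ?_
  rw [Equiv.inv_apply, Units.val_inv_eq_inv_val, inv_inv]

end PowerSums

/-! ### Finite polylogarithms as polynomials: derivatives, boundary values, degrees. -/

section Derivations

variable {p : ℕ} [hp : Fact p.Prime]

/-- A polynomial of degree less than `3p` over `ZMod p` whose derivative vanishes. -/
lemma eq_of_derivative_eq_zero {f : (ZMod p)[X]} (hf : derivative f = 0)
    (hdeg : f.natDegree < 3 * p) :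
    f = C (f.coeff 0) + C (f.coeff p) * X ^ p + C (f.coeff (2 * p)) * (X ^ p) ^ 2 := by
  have hp0 : 0 < p := hp.out.pos
  have he := expand_contract p hf hp0.ne'
  set g := contract p f with hg
  have hgdeg : g.natDegree < 3 := by
    rw [← he, natDegree_expand] at hdeg
    exact lt_of_mul_lt_mul_right hdeg (Nat.zero_le p)
  have h0 : f.coeff 0 = g.coeff 0 := by rw [hg, coeff_contract hp0.ne']; simp
  have h1 : f.coeff p = g.coeff 1 := by rw [hg, coeff_contract hp0.ne']; simp
  have h2 : f.coeff (2 * p) = g.coeff 2 := by rw [hg, coeff_contract hp0.ne']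
  rw [h0, h1, h2]
  conv_lhs => rw [← he, g.as_sum_range_C_mul_X_pow' hgdeg]
  simp [Finset.sum_range_succ]

/-- Below degree `2p` only `a + b X^p` has zero derivative, and the two values force `a = b = 0`.
This is the engine behind the functional equations of weights one and two. -/
lemma eq_zero_of_derivative_eq_zero {f : (ZMod p)[X]} (hf : derivative f = 0)
    (hdeg : f.natDegree < 2 * p) (h0 : f.eval 0 = 0) (h1 : f.eval 1 = 0) : f = 0 := by
  have hp0 : 0 < p := hp.out.pos
  have h := eq_of_derivative_eq_zero hf (by omega)
  rw [coeff_eq_zero_of_natDegree_lt hdeg, coeff_zero_eq_eval_zero, h0] at h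
  rw [h] at h1
  have h2 : f.coeff p = 0 := by simpa using h1
  rw [h, h2]
  simp

variable (p) in
/-- The finite polylogarithm as a polynomial over `ZMod p`. -/
noncomputable def polylogPoly (d : ℕ) : (ZMod p)[X] :=
  ∑ k ∈ Finset.Icc 1 (p - 1), C ((k : ZMod p)⁻¹ ^ d) * X ^ k

variable (p) in
/-- The polynomial `x ^ p £_d(1 - 1 / x)` over `ZMod p`. -/
noncomputable def polylogLanden (d : ℕ) : (ZMod p)[X] :=
  ∑ k ∈ Finset.Icc 1 (p - 1), C ((k : ZMod p)⁻¹ ^ d) * ((X - 1) ^ k * X ^ (p - k))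

lemma X_mul_derivative_polylogPoly (d : ℕ) :
    X * derivative (polylogPoly p (d + 1)) = polylogPoly p d := by
  rw [polylogPoly, polylogPoly, derivative_sum, Finset.mul_sum]
  refine Finset.sum_congr rfl fun k hk => ?_
  have hk0 := natCast_ne_zero_of_mem_Icc hk
  obtain ⟨a, rfl⟩ : ∃ a, k = a + 1 := ⟨k - 1, by rw [Finset.mem_Icc] at hk; omega⟩
  have hc : (C (((a + 1 : ℕ) : ZMod p)⁻¹ ^ (d + 1)) : (ZMod p)[X]) * C ((a + 1 : ℕ) : ZMod p) =
      C (((a + 1 : ℕ) : ZMod p)⁻¹ ^ d) := by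
    rw [← C_mul, pow_succ, mul_assoc, inv_mul_cancel₀ hk0, mul_one]
  rw [derivative_C_mul_X_pow, C_mul, ← hc, Nat.add_sub_cancel]
  ring

lemma one_sub_X_mul_derivative_comp (d : ℕ) :
    (1 - X) * derivative ((polylogPoly p (d + 1)).comp (1 - X)) =
      -(polylogPoly p d).comp (1 - X) := by
  have h := congrArg (fun f => f.comp (1 - X : (ZMod p)[X])) (X_mul_derivative_polylogPoly (p := p) d)
  simp only [mul_comp, X_comp] at h
  rw [derivative_comp, ← h]
  simp only [derivative_sub, derivative_one, derivative_X]
  ring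

/-- The exponents `k` and `p - k` are opposite modulo `p`, so the logarithmic derivative of `(X -
1)^k X^(p-k)` is `k/(X - 1) - k/X = k/(X(X - 1))`. -/
lemma X_mul_derivative_polylogLanden (d : ℕ) :
    X * (X - 1) * derivative (polylogLanden p (d + 1)) = polylogLanden p d := by
  rw [polylogLanden, polylogLanden, derivative_sum, Finset.mul_sum]
  refine Finset.sum_congr rfl fun k hk => ?_
  have hk0 := natCast_ne_zero_of_mem_Icc hk
  rw [Finset.mem_Icc] at hk
  obtain ⟨a, rfl⟩ : ∃ a, k = a + 1 := ⟨k - 1, by omega⟩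
  obtain ⟨b, hb⟩ : ∃ b, p - (a + 1) = b + 1 := ⟨p - (a + 1) - 1, by omega⟩
  rw [hb]
  have hb' : ((b + 1 : ℕ) : ZMod p) = -((a + 1 : ℕ) : ZMod p) := by
    rw [eq_neg_iff_add_eq_zero, ← Nat.cast_add, show b + 1 + (a + 1) = p by omega,
      ZMod.natCast_self]
  have hc : (C (((a + 1 : ℕ) : ZMod p)⁻¹ ^ (d + 1)) : (ZMod p)[X]) * C ((a + 1 : ℕ) : ZMod p) =
      C (((a + 1 : ℕ) : ZMod p)⁻¹ ^ d) := by
    rw [← C_mul, pow_succ, mul_assoc, inv_mul_cancel₀ hk0, mul_one]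
  rw [derivative_C_mul, derivative_mul, derivative_X_pow, derivative_pow, ← hc, hb']
  simp only [derivative_sub, derivative_one, derivative_X, C_neg, Nat.add_sub_cancel]
  ring

lemma one_sub_X_mul_polylogPoly_zero : (1 - X) * polylogPoly p 0 = X - X ^ p := by
  have h := geom_sum_mul_neg (X : (ZMod p)[X]) p
  have h2 : ∑ i ∈ Finset.range p, (X : (ZMod p)[X]) ^ i = 1 + polylogPoly p 0 := by
    rw [Finset.range_eq_Ico, Finset.sum_eq_sum_Ico_succ_bot hp.out.pos, polylogPoly]
    simp only [pow_zero, C_1, one_mul]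
    congr 2
  rw [h2] at h
  linear_combination h

/-- A geometric sum in `X - 1` and `X`, whose difference is `-1`, simplified by `(X - 1)^p = X^p -
1`. -/
lemma polylogLanden_zero : polylogLanden p 0 = X - X ^ p := by
  have h2p := hp.out.two_le
  have h := (Commute.all (X - 1 : (ZMod p)[X]) X).geom_sum₂_mul (p - 1)
  have h2 : polylogLanden p 0 =
      (X - 1) * X * ∑ i ∈ Finset.range (p - 1), (X - 1 : (ZMod p)[X]) ^ i * X ^ (p - 1 - 1 - i) := by
    rw [polylogLanden, Finset.mul_sum, ← Finset.Ico_succ_right_eq_Icc, Finset.sum_Ico_eq_sum_range]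
    refine Finset.sum_congr (by simp) fun i hi => ?_
    rw [Finset.mem_range] at hi
    rw [show p - (1 + i) = (p - 1 - 1 - i) + 1 by omega]
    simp only [pow_zero, C_1]
    ring
  have h3 : (X - 1 : (ZMod p)[X]) ^ p = X ^ p - 1 := by
    rw [sub_pow_char, one_pow]
  have h4 (y : (ZMod p)[X]) : y ^ p = y ^ (p - 1) * y := by
    rw [← pow_succ, Nat.sub_add_cancel hp.out.one_le]
  rw [h2]
  rw [h4 (X - 1), h4 X] at h3
  rw [h4 X]
  linear_combination (-(X - 1) * X) * h - X * h3

lemma eval_zero_polylogPoly (d : ℕ) : (polylogPoly p d).eval 0 = 0 := by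
  rw [polylogPoly, eval_finsetSum]
  refine Finset.sum_eq_zero fun k hk => ?_
  rw [Finset.mem_Icc] at hk
  simp [show k ≠ 0 by omega]

lemma eval_one_polylogPoly {d : ℕ} (hd : 0 < d) (hdp : d < p - 1) :
    (polylogPoly p d).eval 1 = 0 := by
  rw [polylogPoly, eval_finsetSum, ← sum_natCast_inv_pow hd hdp]
  exact Finset.sum_congr rfl fun k _ => by simp

lemma eval_zero_polylogLanden (d : ℕ) : (polylogLanden p d).eval 0 = 0 := by
  have := hp.out.two_le
  rw [polylogLanden, eval_finsetSum]
  refine Finset.sum_eq_zero fun k hk => ?_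
  rw [Finset.mem_Icc] at hk
  simp [show p - k ≠ 0 by omega]

lemma eval_one_polylogLanden (d : ℕ) : (polylogLanden p d).eval 1 = 0 := by
  rw [polylogLanden, eval_finsetSum]
  refine Finset.sum_eq_zero fun k hk => ?_
  rw [Finset.mem_Icc] at hk
  simp [show k ≠ 0 by omega]

lemma natDegree_polylogPoly_le (d : ℕ) : (polylogPoly p d).natDegree ≤ p - 1 := by
  rw [polylogPoly]
  refine natDegree_sum_le_of_forall_le _ _ fun k hk => ?_
  exact (natDegree_C_mul_X_pow_le _ _).trans (Finset.mem_Icc.1 hk).2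

lemma natDegree_polylogPoly_comp_le (d : ℕ) :
    ((polylogPoly p d).comp (1 - X)).natDegree ≤ p - 1 := by
  refine natDegree_comp_le.trans ?_
  have : (1 - X : (ZMod p)[X]).natDegree ≤ 1 := by compute_degree
  exact (Nat.mul_le_mul (natDegree_polylogPoly_le d) this).trans (by simp)

/-- Each summand has degree exactly `p`, but the coefficients of `X^p` add up to `∑ k^{-d} = 0`.
Subtracting `X^p` from every monic product therefore leaves the sum unchanged and lowers each
degree. -/
lemma natDegree_polylogLanden_le {d : ℕ} (hd : 0 < d) (hdp : d < p - 1) :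
    (polylogLanden p d).natDegree ≤ p - 1 := by
  have h : polylogLanden p d = ∑ k ∈ Finset.Icc 1 (p - 1),
      C ((k : ZMod p)⁻¹ ^ d) * ((X - C 1) ^ k * X ^ (p - k) - X ^ p) := by
    simp only [mul_sub, Finset.sum_sub_distrib]
    rw [← Finset.sum_mul, ← map_sum, sum_natCast_inv_pow hd hdp, polylogLanden]
    simp
  rw [h]
  refine natDegree_sum_le_of_forall_le _ _ fun k hk => ?_
  rw [Finset.mem_Icc] at hk
  refine (natDegree_C_mul_le _ _).trans ?_
  have hm : ((X - C 1 : (ZMod p)[X]) ^ k * X ^ (p - k)).Monic :=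
    ((monic_X_sub_C 1).pow k).mul (monic_X_pow _)
  have hd1 : ((X - C 1 : (ZMod p)[X]) ^ k * X ^ (p - k)).natDegree = p := by
    rw [((monic_X_sub_C 1).pow k).natDegree_mul (monic_X_pow _),
      (monic_X_sub_C (1 : ZMod p)).natDegree_pow, natDegree_X_sub_C, natDegree_X_pow]
    have := hp.out.two_le
    omega
  have hlt := degree_sub_lt_left (p := (X - C 1 : (ZMod p)[X]) ^ k * X ^ (p - k)) (q := X ^ p)
    (by rw [degree_eq_natDegree hm.ne_zero, hd1, degree_X_pow]) hm.ne_zero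
    (by rw [hm.leadingCoeff, (monic_X_pow p).leadingCoeff])
  rw [degree_eq_natDegree hm.ne_zero, hd1] at hlt
  exact natDegree_le_iff_coeff_eq_zero.2 fun N hN =>
    (degree_lt_iff_coeff_zero _ _).1 hlt N (by omega)

lemma derivative_X_pow_char : derivative ((X : (ZMod p)[X]) ^ p) = 0 := by
  rw [derivative_X_pow, ZMod.natCast_self]; simp

lemma X_mul_one_sub_X_ne_zero : (X * (1 - X) : (ZMod p)[X]) ≠ 0 := by
  have : (1 - X : (ZMod p)[X]) ≠ 0 := by
    rw [← neg_ne_zero, neg_sub]; exact X_sub_C_ne_zero 1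
  exact mul_ne_zero X_ne_zero this

end Derivations

/-! ### Functional equations in weights one, two and three. -/

section Identities

variable {p : ℕ} [hp : Fact p.Prime]

lemma X_mul_polylogPoly_zero_comp :
    X * (polylogPoly p 0).comp (1 - X) = X ^ p - X := by
  have h := congrArg (fun f => f.comp (1 - X : (ZMod p)[X]))
    (one_sub_X_mul_polylogPoly_zero (p := p))
  simp only [mul_comp, sub_comp, one_comp, X_comp, pow_comp] at h
  rw [sub_pow_char, one_pow] at h
  linear_combination h

lemma eval_polylogPoly_comp (d : ℕ) (x : ZMod p) :
    ((polylogPoly p d).comp (1 - X)).eval x = (polylogPoly p d).eval (1 - x) := by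
  simp [eval_comp]

lemma polylogPoly_one_comp (hp2 : 2 < p) :
    (polylogPoly p 1).comp (1 - X) = polylogPoly p 1 := by
  rw [← sub_eq_zero]
  have e0 := eval_zero_polylogPoly (p := p) 1
  have e1 := eval_one_polylogPoly (p := p) (d := 1) one_pos (by omega)
  refine eq_zero_of_derivative_eq_zero ?_ ?_ ?_ ?_
  -- Multiplying the derivative by `X(1 - X)` clears the denominators of the differential equations;
  -- the same device is used in the later identities.
  · refine (mul_eq_zero.1 ?_).resolve_left X_mul_one_sub_X_ne_zero
    rw [derivative_sub]
    linear_combination X * one_sub_X_mul_derivative_comp (p := p) 0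
      - (1 - X) * X_mul_derivative_polylogPoly (p := p) 0
      - X_mul_polylogPoly_zero_comp (p := p) - one_sub_X_mul_polylogPoly_zero (p := p)
  · refine lt_of_le_of_lt (natDegree_sub_le_of_le (natDegree_polylogPoly_comp_le 1)
      (natDegree_polylogPoly_le 1)) ?_
    rw [max_self]; omega
  · rw [eval_sub, eval_polylogPoly_comp, sub_zero, e0, e1, sub_zero]
  · rw [eval_sub, eval_polylogPoly_comp, sub_self, e0, e1, sub_zero]

lemma polylogLanden_one (hp2 : 2 < p) : polylogLanden p 1 = -polylogPoly p 1 := by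
  rw [← sub_eq_zero]
  have e0 := eval_zero_polylogPoly (p := p) 1
  have e1 := eval_one_polylogPoly (p := p) (d := 1) one_pos (by omega)
  refine eq_zero_of_derivative_eq_zero ?_ ?_ ?_ ?_
  · refine (mul_eq_zero.1 ?_).resolve_left X_mul_one_sub_X_ne_zero
    rw [derivative_sub, derivative_neg]
    linear_combination (1 - X) * X_mul_derivative_polylogPoly (p := p) 0
      - X_mul_derivative_polylogLanden (p := p) 0
      - polylogLanden_zero (p := p) + one_sub_X_mul_polylogPoly_zero (p := p)
  · refine lt_of_le_of_lt (natDegree_sub_le_of_le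
      (natDegree_polylogLanden_le one_pos (by omega))
      ((natDegree_neg _).le.trans (natDegree_polylogPoly_le 1))) ?_
    rw [max_self]; omega
  · rw [eval_sub, eval_zero_polylogLanden, eval_neg, e0, neg_zero, sub_zero]
  · rw [eval_sub, eval_one_polylogLanden, eval_neg, e1, neg_zero, sub_zero]

lemma natDegree_X_pow_mul_lt {f : (ZMod p)[X]} {n : ℕ} (hf : f.natDegree < n) :
    (X ^ p * f).natDegree < n + p := by
  have h : (X ^ p * f).natDegree ≤ p + f.natDegree :=
    natDegree_mul_le_of_le (natDegree_X_pow_le p) le_rfl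
  omega

lemma natDegree_add_lt {f g : (ZMod p)[X]} {n : ℕ} (hf : f.natDegree < n) (hg : g.natDegree < n) :
    (f + g).natDegree < n :=
  (natDegree_add_le f g).trans_lt (max_lt hf hg)

lemma natDegree_sub_lt_of_lt {f g : (ZMod p)[X]} {n : ℕ} (hf : f.natDegree < n)
    (hg : g.natDegree < n) : (f - g).natDegree < n :=
  (natDegree_sub_le f g).trans_lt (max_lt hf hg)

lemma natDegree_natCast_mul_lt {f : (ZMod p)[X]} {n : ℕ} (m : ℕ) (hf : f.natDegree < n) :
    ((m : (ZMod p)[X]) * f).natDegree < n := by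
  rw [← C_eq_natCast]
  exact (natDegree_C_mul_le _ _).trans_lt hf

lemma natDegree_polylogPoly_lt (d : ℕ) : (polylogPoly p d).natDegree < p :=
  (natDegree_polylogPoly_le d).trans_lt (Nat.sub_lt hp.out.pos one_pos)

lemma natDegree_polylogPoly_comp_lt (d : ℕ) : ((polylogPoly p d).comp (1 - X)).natDegree < p :=
  (natDegree_polylogPoly_comp_le d).trans_lt (Nat.sub_lt hp.out.pos one_pos)

lemma natDegree_polylogLanden_lt {d : ℕ} (hd : 0 < d) (hdp : d < p - 1) :
    (polylogLanden p d).natDegree < p :=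
  (natDegree_polylogLanden_le hd hdp).trans_lt (Nat.sub_lt hp.out.pos one_pos)

lemma natDegree_polylogPoly_sq_lt (d : ℕ) : (polylogPoly p d ^ 2).natDegree < p + p := by
  rw [sq]
  have h : (polylogPoly p d * polylogPoly p d).natDegree ≤ (p - 1) + (p - 1) :=
    natDegree_mul_le_of_le (natDegree_polylogPoly_le d) (natDegree_polylogPoly_le d)
  have := hp.out.pos
  omega

lemma natDegree_polylogPoly_cube_lt (d : ℕ) : (polylogPoly p d ^ 3).natDegree < p + p + p := by
  rw [pow_succ]
  have h : (polylogPoly p d ^ 2 * polylogPoly p d).natDegree ≤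
      (polylogPoly p d ^ 2).natDegree + (polylogPoly p d).natDegree := natDegree_mul_le
  have := natDegree_polylogPoly_sq_lt (p := p) d
  have := natDegree_polylogPoly_lt (p := p) d
  omega

/-- The reflection formula for the finite dilogarithm. -/
lemma polylogPoly_two_reflection (hp3 : 3 < p) :
    polylogPoly p 1 ^ 2 + 2 * (X ^ p * polylogPoly p 2) +
      2 * ((polylogPoly p 2).comp (1 - X) - X ^ p * (polylogPoly p 2).comp (1 - X)) = 0 := by
  have e0 (d) := eval_zero_polylogPoly (p := p) d
  have e1 := eval_one_polylogPoly (p := p) (d := 1) one_pos (by omega)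
  have e2 := eval_one_polylogPoly (p := p) (d := 2) two_pos (by omega)
  refine eq_zero_of_derivative_eq_zero ?_ ?_ ?_ ?_
  · refine (mul_eq_zero.1 ?_).resolve_left X_mul_one_sub_X_ne_zero
    have h1 := X_mul_derivative_polylogPoly (p := p) 0
    have h2 := X_mul_derivative_polylogPoly (p := p) 1
    have h3 := one_sub_X_mul_derivative_comp (p := p) 1
    have h4 := one_sub_X_mul_polylogPoly_zero (p := p)
    have h5 := polylogPoly_one_comp (p := p) (by omega)
    rw [sq (polylogPoly p 1)]
    simp only [derivative_add, derivative_sub, derivative_mul, derivative_X_pow_char,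
      derivative_ofNat, zero_mul, zero_add]
    linear_combination (exp := 1) 2 * polylogPoly p 1 * (1 - X) * h1
      + 2 * polylogPoly p 1 * h4
      + 2 * X ^ p * (1 - X) * h2 + 2 * (1 - X ^ p) * X * h3 - 2 * (1 - X ^ p) * X * h5
  · rw [two_mul p]
    have a := natDegree_X_pow_mul_lt (natDegree_polylogPoly_lt (p := p) 2)
    have b := natDegree_X_pow_mul_lt (natDegree_polylogPoly_comp_lt (p := p) 2)
    have c := natDegree_polylogPoly_comp_lt (p := p) 2
    exact natDegree_add_lt (natDegree_add_lt (natDegree_polylogPoly_sq_lt 1)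
      (natDegree_natCast_mul_lt 2 a))
      (natDegree_natCast_mul_lt 2 (natDegree_sub_lt_of_lt (by omega) b))
  · simp [eval_comp, e0, e2, hp.out.ne_zero]
  · simp [eval_comp, e1, e2]

/-- The Landen formula for the finite dilogarithm. -/
lemma polylogPoly_two_landen (hp3 : 3 < p) :
    polylogPoly p 1 ^ 2 + 2 * polylogPoly p 2 +
      2 * (X ^ p * polylogLanden p 2 - polylogLanden p 2) = 0 := by
  have e0 (d) := eval_zero_polylogPoly (p := p) d
  have e1 := eval_one_polylogPoly (p := p) (d := 1) one_pos (by omega)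
  have e2 := eval_one_polylogPoly (p := p) (d := 2) two_pos (by omega)
  refine eq_zero_of_derivative_eq_zero ?_ ?_ ?_ ?_
  · refine (mul_eq_zero.1 ?_).resolve_left X_mul_one_sub_X_ne_zero
    have h1 := X_mul_derivative_polylogPoly (p := p) 0
    have h2 := X_mul_derivative_polylogPoly (p := p) 1
    have h3 := X_mul_derivative_polylogLanden (p := p) 1
    have h4 := one_sub_X_mul_polylogPoly_zero (p := p)
    have h5 := polylogLanden_one (p := p) (by omega)
    rw [sq (polylogPoly p 1)]
    simp only [derivative_add, derivative_sub, derivative_mul, derivative_X_pow_char,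
      derivative_ofNat, zero_mul, zero_add]
    linear_combination (exp := 1) 2 * polylogPoly p 1 * (1 - X) * h1
      + 2 * polylogPoly p 1 * h4
      + 2 * (1 - X) * h2 + 2 * (1 - X ^ p) * h3 + 2 * (1 - X ^ p) * h5
  · rw [two_mul p]
    have a := natDegree_polylogLanden_lt (p := p) (d := 2) two_pos (by omega)
    have b := natDegree_polylogPoly_lt (p := p) 2
    have c := natDegree_natCast_mul_lt 2 b
    exact natDegree_add_lt (natDegree_add_lt (natDegree_polylogPoly_sq_lt 1)
      (c.trans_le (by omega)))
      (natDegree_natCast_mul_lt 2 (natDegree_sub_lt_of_lt (natDegree_X_pow_mul_lt a) (by omega)))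
  · simp [e0, eval_zero_polylogLanden, hp.out.ne_zero]
  · simp [e1, e2]

/-- The Landen formula for the finite trilogarithm. -/
lemma polylogPoly_three_landen (hp4 : 4 < p) :
    6 * (X ^ p * polylogPoly p 3
        + ((polylogPoly p 3).comp (1 - X) - X ^ p * (polylogPoly p 3).comp (1 - X))
        + (X ^ p * polylogLanden p 3 - X ^ p * (X ^ p * polylogLanden p 3)))
      - polylogPoly p 1 ^ 3 =
    C (-(polylogPoly p 1 ^ 3).coeff p) * (X ^ p - (X ^ p) ^ 2) := by
  have hp0 := hp.out.ne_zero
  have e0 (d) := eval_zero_polylogPoly (p := p) d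
  have e1 := eval_one_polylogPoly (p := p) (d := 1) one_pos (by omega)
  have e3 := eval_one_polylogPoly (p := p) (d := 3) three_pos (by omega)
  set P : (ZMod p)[X] := 6 * (X ^ p * polylogPoly p 3
        + ((polylogPoly p 3).comp (1 - X) - X ^ p * (polylogPoly p 3).comp (1 - X))
        + (X ^ p * polylogLanden p 3 - X ^ p * (X ^ p * polylogLanden p 3)))
      - polylogPoly p 1 ^ 3 with hP
  have hd : derivative P = 0 := by
    refine (mul_eq_zero.1 ?_).resolve_left X_mul_one_sub_X_ne_zero
    have h1 := X_mul_derivative_polylogPoly (p := p) 0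
    have h2 := X_mul_derivative_polylogPoly (p := p) 2
    have h3 := X_mul_derivative_polylogLanden (p := p) 2
    have h4 := one_sub_X_mul_polylogPoly_zero (p := p)
    have h5 := one_sub_X_mul_derivative_comp (p := p) 2
    -- After differentiation only weight-two terms and `£_1^2` times weight zero remain, a
    -- combination of the reflection and Landen formulas of weight two.
    have h6 := polylogPoly_two_reflection (p := p) (by omega)
    have h7 := polylogPoly_two_landen (p := p) (by omega)
    have hc : polylogPoly p 1 ^ 3 = polylogPoly p 1 * polylogPoly p 1 * polylogPoly p 1 := by ring
    rw [hP, hc]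
    simp only [derivative_add, derivative_sub, derivative_mul, derivative_X_pow_char,
      derivative_ofNat, zero_mul, zero_add]
    linear_combination (exp := 1) -3 * polylogPoly p 1 ^ 2 * (1 - X) * h1
      - 3 * polylogPoly p 1 ^ 2 * h4
      + 6 * X ^ p * (1 - X) * h2 + 6 * (1 - X ^ p) * X * h5 - 6 * (1 - X ^ p) * X ^ p * h3
      - 3 * X * h6 + 3 * X ^ p * h7
  have hdeg : P.natDegree < 3 * p := by
    have a := natDegree_polylogLanden_lt (p := p) (d := 3) three_pos (by omega)
    have a1 := natDegree_X_pow_mul_lt a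
    have a2 := natDegree_X_pow_mul_lt a1
    have b := natDegree_X_pow_mul_lt (natDegree_polylogPoly_lt (p := p) 3)
    have c := natDegree_polylogPoly_comp_lt (p := p) 3
    have c1 := natDegree_X_pow_mul_lt c
    rw [show 3 * p = p + p + p by ring]
    exact natDegree_sub_lt_of_lt (natDegree_natCast_mul_lt 6 (natDegree_add_lt (natDegree_add_lt
      (by omega) (natDegree_sub_lt_of_lt (by omega) (by omega)))
      (natDegree_sub_lt_of_lt (by omega) a2))) (natDegree_polylogPoly_cube_lt 1)
  have h0 : P.coeff 0 = 0 := by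
    rw [coeff_zero_eq_eval_zero]
    simp [hP, eval_comp, e0, e3, hp0]
  have hE1 : P.eval 1 = 0 := by
    simp [hP, eval_comp, e0, e1, e3, eval_one_polylogLanden]
  -- A term `X^p g` contributes `g(0)`, which is zero for each `g` here, and the reflected
  -- polylogarithm has degree below `p`; only the cube contributes.
  have hcp : P.coeff p = -(polylogPoly p 1 ^ 3).coeff p := by
    have hX (f : (ZMod p)[X]) : (X ^ p * f).coeff p = f.eval 0 := by
      rw [← coeff_zero_eq_eval_zero, coeff_X_pow_mul', if_pos le_rfl, Nat.sub_self]
    have h6 (f : (ZMod p)[X]) : (6 * f).coeff p = 6 * f.coeff p :=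
      coeff_natCast_mul (a := 6)
    rw [hP, coeff_sub, h6]
    simp only [coeff_add, coeff_sub, hX]
    rw [coeff_eq_zero_of_natDegree_lt (natDegree_polylogPoly_comp_lt 3)]
    simp [eval_comp, e0, e3, eval_zero_polylogLanden, hp0]
  have h := eq_of_derivative_eq_zero hd hdeg
  rw [h0] at h
  rw [h] at hE1
  have h2 : P.coeff (2 * p) = -P.coeff p := by
    simp only [map_zero, zero_add, eval_add, eval_mul, eval_C, eval_pow, eval_X, one_pow,
      mul_one] at hE1
    linear_combination hE1
  rw [h2, C_neg, C_0] at h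
  rw [← hcp]
  linear_combination h

end Identities

/-! ### The leftover constant as a multiple harmonic sum. -/

section Coefficients

variable {p : ℕ} [hp : Fact p.Prime]

lemma coeff_polylogPoly {d n : ℕ} (hn : n ∈ Finset.Icc 1 (p - 1)) :
    (polylogPoly p d).coeff n = (n : ZMod p)⁻¹ ^ d := by
  rw [polylogPoly, finsetSum_coeff]
  simp only [coeff_C_mul_X_pow]
  rw [Finset.sum_ite_eq, if_pos hn]

lemma coeff_zero_polylogPoly (d : ℕ) : (polylogPoly p d).coeff 0 = 0 := by
  rw [coeff_zero_eq_eval_zero, eval_zero_polylogPoly]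

/-- Compare coefficients in `X (£_1^2)' = 2 £_1 £_0`: since `£_0` has all coefficients `1` in
degrees `1` to `p - 1`, the right side yields `2 H_{n-1}`. The index `j = 0` is harmless because
`0⁻¹ = 0` in `ZMod p`. -/
lemma coeff_polylogPoly_one_sq {n : ℕ} (hn : n ∈ Finset.Icc 1 (p - 1)) :
    (polylogPoly p 1 ^ 2).coeff n =
      2 * (n : ZMod p)⁻¹ * ∑ j ∈ Finset.range n, (j : ZMod p)⁻¹ := by
  have hn0 := natCast_ne_zero_of_mem_Icc hn
  have hd : X * derivative (polylogPoly p 1 ^ 2) = C 2 * (polylogPoly p 1 * polylogPoly p 0) := by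
    rw [sq, derivative_mul, ← X_mul_derivative_polylogPoly (p := p) 0, map_ofNat]
    ring
  rw [Finset.mem_Icc] at hn
  have h := congrArg (fun f => f.coeff n) hd
  obtain ⟨m, rfl⟩ : ∃ m, n = m + 1 := ⟨n - 1, by omega⟩
  have hs : (polylogPoly p 1 * polylogPoly p 0).coeff (m + 1) =
      ∑ j ∈ Finset.range (m + 1), (j : ZMod p)⁻¹ := by
    rw [coeff_mul, Finset.Nat.sum_antidiagonal_eq_sum_range_succ
      (fun i j => (polylogPoly p 1).coeff i * (polylogPoly p 0).coeff j), Finset.sum_range_succ,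
      Nat.sub_self, coeff_zero_polylogPoly, mul_zero, add_zero]
    refine Finset.sum_congr rfl fun j hj => ?_
    rw [Finset.mem_range] at hj
    rw [coeff_polylogPoly (n := m + 1 - j) (Finset.mem_Icc.2 (by omega)), pow_zero, mul_one]
    rcases Nat.eq_zero_or_pos j with rfl | hj0
    · rw [coeff_zero_polylogPoly]; simp
    · rw [coeff_polylogPoly (Finset.mem_Icc.2 (by omega)), pow_one]
  simp only [coeff_X_mul, coeff_derivative, coeff_C_mul, hs] at h
  push_cast at hn0 h ⊢
  rw [mul_right_comm, eq_mul_inv_iff_mul_eq₀ hn0, h]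

/-- Convolve `£_1^2` with `£_1`, using `1/(p - n) = -1/n` modulo `p`. -/
lemma coeff_polylogPoly_one_cube :
    (polylogPoly p 1 ^ 3).coeff p = -2 * ∑ n ∈ Finset.Icc 1 (p - 1),
      (n : ZMod p)⁻¹ ^ 2 * ∑ j ∈ Finset.range n, (j : ZMod p)⁻¹ := by
  have hp0 := hp.out.pos
  rw [pow_succ, coeff_mul, Finset.Nat.sum_antidiagonal_eq_sum_range_succ
      (fun i j => (polylogPoly p 1 ^ 2).coeff i * (polylogPoly p 1).coeff j), Finset.sum_range_succ,
      Nat.sub_self, coeff_zero_polylogPoly, mul_zero, add_zero, Finset.range_eq_Ico,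
      Finset.sum_eq_sum_Ico_succ_bot hp0, Finset.mul_sum]
  have h0 : (polylogPoly p 1 ^ 2).coeff 0 = 0 := by
    rw [sq, mul_coeff_zero, coeff_zero_polylogPoly, zero_mul]
  have hI : Finset.Ico (0 + 1) p = Finset.Icc 1 (p - 1) := by
    ext k; simp only [Finset.mem_Ico, Finset.mem_Icc]; omega
  rw [h0, zero_mul, zero_add, hI]
  refine Finset.sum_congr rfl fun n hn => ?_
  have hn' := Finset.mem_Icc.1 hn
  rw [coeff_polylogPoly_one_sq hn, coeff_polylogPoly (Finset.mem_Icc.2 (by omega)), pow_one,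
    Nat.cast_sub (by omega), ZMod.natCast_self, zero_sub, inv_neg]
  ring

end Coefficients

/-! ### Inversion, Landen substitution and distribution in a `ZMod p`-algebra. -/

section Evaluation

variable {p : ℕ} [hp : Fact p.Prime] {K : Type*} [CommRing K] [Algebra (ZMod p) K]

lemma aeval_polylogPoly (d : ℕ) (x : K) :
    aeval x (polylogPoly p d) =
      ∑ k ∈ Finset.Icc 1 (p - 1), algebraMap (ZMod p) K ((k : ZMod p)⁻¹ ^ d) * x ^ k := by
  simp [polylogPoly]

/-- The inversion relation. -/
lemma aeval_polylogPoly_inversion (hp2 : 2 < p) (d : ℕ) {x y : K} (hxy : x * y = 1) :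
    aeval x (polylogPoly p d) = (-1) ^ d * x ^ p * aeval y (polylogPoly p d) := by
  rw [aeval_polylogPoly, aeval_polylogPoly, Finset.mul_sum]
  -- Reversing the sum negates the index modulo `p`, which produces the sign `(-1)^d`.
  refine Finset.sum_nbij' (fun k => p - k) (fun k => p - k) ?_ ?_ ?_ ?_ ?_
  · intro k hk; simp only [Finset.mem_Icc] at hk ⊢; omega
  · intro k hk; simp only [Finset.mem_Icc] at hk ⊢; omega
  · intro k hk; simp only [Finset.mem_Icc] at hk; omega
  · intro k hk; simp only [Finset.mem_Icc] at hk; omega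
  · intro k hk
    rw [Finset.mem_Icc] at hk
    have h1 : x ^ p * y ^ (p - k) = x ^ k := by
      obtain ⟨b, hb⟩ : ∃ b, p = k + b := ⟨p - k, by omega⟩
      rw [show p - k = b by omega, hb, pow_add, mul_assoc, ← mul_pow, hxy, one_pow, mul_one]
    rw [Nat.cast_sub (by omega), ZMod.natCast_self, zero_sub, inv_neg, neg_pow (k : ZMod p)⁻¹, map_mul, ← h1]
    have h2 : (-1 : K) ^ d * (-1) ^ d = 1 := by rw [← mul_pow]; simp
    simp only [map_pow, map_neg, map_one]
    linear_combination (-(algebraMap (ZMod p) K (k : ZMod p)⁻¹ ^ d * (x ^ p * y ^ (p - k)))) * h2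

lemma aeval_polylogLanden (d : ℕ) {x y : K} (hxy : x * y = 1) :
    aeval x (polylogLanden p d) = x ^ p * aeval (1 - y) (polylogPoly p d) := by
  rw [aeval_polylogPoly, Finset.mul_sum, polylogLanden, map_sum]
  refine Finset.sum_congr rfl fun k hk => ?_
  rw [Finset.mem_Icc] at hk
  obtain ⟨b, hb⟩ : ∃ b, p = k + b := ⟨p - k, by omega⟩
  have h1 : x ^ p = x ^ k * x ^ b := by rw [← pow_add, ← hb]
  have h2 : x - 1 = x * (1 - y) := by rw [mul_sub, hxy, mul_one]
  simp only [map_mul, map_pow, aeval_C, aeval_X, map_sub, map_one]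
  rw [h1, show p - k = b by omega, h2, mul_pow]
  ring

lemma sum_range_two_mul {M : Type*} [AddCommMonoid M] (f : ℕ → M) (m : ℕ) :
    ∑ k ∈ Finset.range (2 * m), f k = ∑ i ∈ Finset.range m, (f (2 * i) + f (2 * i + 1)) := by
  induction m with
  | zero => simp
  | succ m ih => rw [Finset.sum_range_succ, ← ih, mul_add, mul_one, Finset.sum_range_succ,
      Finset.sum_range_succ, add_assoc]

/-- The distribution relation for squares. -/
lemma aeval_polylogPoly_distribution (hp2 : 2 < p) (d : ℕ) (x : K) :
    aeval (x ^ 2) (polylogPoly p (d + 1)) =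
      2 ^ d * ((1 + x ^ p) * aeval x (polylogPoly p (d + 1)) +
        (1 - x ^ p) * aeval (-x) (polylogPoly p (d + 1))) := by
  obtain ⟨m, hm⟩ : ∃ m, p = 2 * m + 1 := (hp.out.odd_of_ne_two (by omega))
  have h2 : (2 : ZMod p) ≠ 0 := by
    have := natCast_ne_zero_of_mem_Icc (p := p) (k := 2) (Finset.mem_Icc.2 (by omega))
    exact_mod_cast this
  set c : ℕ → K := fun k => algebraMap (ZMod p) K ((k : ZMod p)⁻¹ ^ (d + 1)) with hc
  have hI (f : ℕ → K) : ∑ k ∈ Finset.Icc 1 (p - 1), f k = ∑ i ∈ Finset.range (2 * m), f (i + 1) := by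
    rw [← Finset.Ico_succ_right_eq_Icc, Finset.sum_Ico_eq_sum_range]
    refine Finset.sum_congr (congrArg _ ?_) fun i _ => by rw [add_comm]
    simp only [Order.succ_eq_add_one]; omega
  have hc2 (k l : ℕ) (h : (l : ZMod p) = 2 * (k : ZMod p)) : 2 ^ (d + 1) * c l = c k := by
    simp only [hc]
    rw [h, mul_inv, mul_pow, map_mul, ← mul_assoc]
    have : (2 : K) ^ (d + 1) = algebraMap (ZMod p) K (2 ^ (d + 1)) := by
      rw [map_pow, map_ofNat]
    rw [this, ← map_mul, ← mul_pow, mul_inv_cancel₀ h2, one_pow, map_one, one_mul]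
  simp only [aeval_polylogPoly]
  change ∑ k ∈ Finset.Icc 1 (p - 1), c k * (x ^ 2) ^ k =
    2 ^ d * ((1 + x ^ p) * ∑ k ∈ Finset.Icc 1 (p - 1), c k * x ^ k +
      (1 - x ^ p) * ∑ k ∈ Finset.Icc 1 (p - 1), c k * (-x) ^ k)
  have hL : ∑ k ∈ Finset.Icc 1 (p - 1), c k * (x ^ 2) ^ k = ∑ i ∈ Finset.range m,
      (c (i + 1) * (x ^ 2) ^ (i + 1) + c (m + i + 1) * (x ^ 2) ^ (m + i + 1)) := by
    rw [hI, two_mul, Finset.sum_range_add, ← Finset.sum_add_distrib]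
  have hR (y : K) : ∑ k ∈ Finset.Icc 1 (p - 1), c k * y ^ k = ∑ i ∈ Finset.range m,
      (c (2 * i + 1) * y ^ (2 * i + 1) + c (2 * i + 1 + 1) * y ^ (2 * i + 1 + 1)) := by
    rw [hI, sum_range_two_mul]
  rw [hL, hR, hR, Finset.mul_sum, Finset.mul_sum, ← Finset.sum_add_distrib, Finset.mul_sum]
  refine Finset.sum_congr rfl fun i _ => ?_
  -- With `p = 2m + 1`, doubling sends the lower half of the indices to the even ones, and the upper
  -- half to `p` plus the odd ones; the extra `p` accounts for the factor `x^p`.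
  have ha := hc2 (i + 1) (2 * i + 1 + 1) (by push_cast; ring)
  have hb := hc2 (m + i + 1) (2 * i + 1) (by
    have := ZMod.natCast_self p
    rw [show ((p : ℕ) : ZMod p) = ((2 * m + 1 : ℕ) : ZMod p) by rw [← hm]] at this
    push_cast at this ⊢
    linear_combination -this)
  have hxp : x ^ p = (x ^ 2) ^ m * x := by
    rw [← pow_mul, ← pow_succ, ← hm]
  have n1 : (-x) ^ (2 * i + 1) = -x ^ (2 * i + 1) := Odd.neg_pow ⟨i, rfl⟩ x
  have n2 : (-x) ^ (2 * i + 1 + 1) = x ^ (2 * i + 1 + 1) := Even.neg_pow ⟨i + 1, by ring⟩ x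
  rw [← ha, ← hb, n1, n2, hxp]
  ring

end Evaluation

/-! ### Solving the functional equations at the golden ratio. -/

section Golden

variable {p : ℕ} [hp : Fact p.Prime] {K : Type*} [CommRing K] [CharP K p] [Algebra (ZMod p) K]

/-- The values of the finite dilogarithm at a root `φ` of `x ^ 2 = x + 1` in characteristic `p`. -/
lemma aeval_polylogPoly_two_golden (hp3 : 3 < p) {φ : K} (hφ : φ ^ 2 = φ + 1) :
    10 * aeval φ (polylogPoly p 2) = -(2 * φ ^ p - 1) * aeval φ (polylogPoly p 1) ^ 2 ∧
    10 * aeval (φ ^ 2) (polylogPoly p 2) = -(2 * φ ^ p + 4) * aeval φ (polylogPoly p 1) ^ 2 ∧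
    20 * aeval (-φ) (polylogPoly p 2) = -(2 * φ ^ p + 4) * aeval φ (polylogPoly p 1) ^ 2 := by
  have hodd : Odd p := hp.out.odd_of_ne_two (by omega)
  have hf : (φ ^ p) ^ 2 = φ ^ p + 1 := by
    rw [← pow_mul, mul_comm, pow_mul, hφ, add_pow_char, one_pow]
  -- These relations say `1 - φ = -1/φ`, `φ - 1 = 1/φ` and `1 - 1/φ = 1/φ²`, so each argument in the
  -- functional equations is, up to inversion, one of `φ`, `-φ`, `φ²`.
  have h1 : -φ * (1 - φ) = 1 := by linear_combination hφ
  have h2 : φ * (φ - 1) = 1 := by linear_combination hφ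
  have h3 : φ ^ 2 * (1 - (φ - 1)) = 1 := by linear_combination (1 - φ) * hφ
  have e1 := congrArg (aeval φ) (polylogPoly_two_reflection (p := p) hp3)
  have e2 := congrArg (aeval φ) (polylogPoly_two_landen (p := p) hp3)
  have e3 := aeval_polylogPoly_inversion (p := p) (by omega) 2 h1
  have e4 := aeval_polylogPoly_inversion (p := p) (by omega) 2 h3
  have e5 := aeval_polylogPoly_distribution (p := p) (by omega) 1 φ
  simp only [map_add, map_sub, map_mul, map_pow, map_ofNat, map_zero, aeval_X, aeval_comp, map_one,
    aeval_polylogLanden 2 h2] at e1 e2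
  rw [hodd.neg_pow] at e3
  rw [← pow_mul, mul_comm 2 p, pow_mul] at e4
  set f := φ ^ p
  set A := aeval φ (polylogPoly p 2)
  set B := aeval (-φ) (polylogPoly p 2)
  set D := aeval (φ ^ 2) (polylogPoly p 2)
  set L := aeval φ (polylogPoly p 1)
  set U := aeval (1 - φ) (polylogPoly p 2)
  set W := aeval (1 - (φ - 1)) (polylogPoly p 2)
  have hg : f * (f - 1) = 1 := by linear_combination hf
  have hU : U = -(f - 1) * B := by linear_combination (f - 1) * e3 - U * hg
  have hW : f ^ 2 * W = D := by linear_combination -e4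
  have r1 : f ^ 2 * L ^ 2 + 2 * f ^ 3 * A + 2 * B = 0 := by
    rw [hU] at e1
    linear_combination f ^ 2 * e1 - 2 * B * (f * (f - 1) + 1) * hg
  have r2 : f ^ 2 * L ^ 2 + 2 * f ^ 2 * A + 2 * D = 0 := by
    linear_combination f ^ 2 * e2 - 2 * (f - 1) * f * hW - 2 * D * hg
  have r3 : D = 2 * f ^ 2 * A - 2 * (f - 1) * B := by
    linear_combination e5 - 2 * A * hf
  have hA : 10 * A = -(2 * f - 1) * L ^ 2 := by
    -- The combination `r2 + 2(f - 1) r1 - 2 r3` eliminates `B` and `D`. The factor `f²` is then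
    -- removed using its inverse `(f - 1)²`, as `K` need not be a domain.
    have h : f ^ 2 * (10 * A + (2 * f - 1) * L ^ 2) = 0 := by
      linear_combination r2 + 2 * (f - 1) * r1 - 2 * r3 - 4 * f ^ 2 * A * hg
    have h' : (f - 1) ^ 2 * f ^ 2 = 1 := by linear_combination (f * (f - 1) + 1) * hg
    linear_combination (f - 1) ^ 2 * h - (10 * A + (2 * f - 1) * L ^ 2) * h'
  refine ⟨hA, ?_, ?_⟩
  · linear_combination 5 * r2 - f ^ 2 * hA + L ^ 2 * (2 * f - 4) * hf
  · linear_combination 10 * r1 - 2 * f ^ 3 * hA + L ^ 2 * (4 * f ^ 2 + 2 * f - 4) * hf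

/-- The value of the finite trilogarithm at the square of a root `φ` of `x ^ 2 = x + 1` in
characteristic `p`. -/
lemma aeval_polylogPoly_three_golden (hp4 : 4 < p) {φ : K} (hφ : φ ^ 2 = φ + 1) :
    15 * aeval (φ ^ 2) (polylogPoly p 3) = 2 * φ ^ p * (aeval φ (polylogPoly p 1) ^ 3 +
      algebraMap (ZMod p) K ((polylogPoly p 1 ^ 3).coeff p)) := by
  have hodd : Odd p := hp.out.odd_of_ne_two (by omega)
  have hf : (φ ^ p) ^ 2 = φ ^ p + 1 := by
    rw [← pow_mul, mul_comm, pow_mul, hφ, add_pow_char, one_pow]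
  have h1 : -φ * (1 - φ) = 1 := by linear_combination hφ
  have h2 : φ * (φ - 1) = 1 := by linear_combination hφ
  have h3 : φ ^ 2 * (1 - (φ - 1)) = 1 := by linear_combination (1 - φ) * hφ
  have e1 := congrArg (aeval φ) (polylogPoly_three_landen (p := p) hp4)
  have e3 := aeval_polylogPoly_inversion (p := p) (by omega) 3 h1
  have e4 := aeval_polylogPoly_inversion (p := p) (by omega) 3 h3
  have e5 := aeval_polylogPoly_distribution (p := p) (by omega) 2 φ
  simp only [map_add, map_sub, map_mul, map_pow, map_ofNat, aeval_X, aeval_comp, map_one,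
    aeval_polylogLanden 3 h2, map_neg, aeval_C] at e1
  rw [hodd.neg_pow] at e3
  rw [← pow_mul, mul_comm 2 p, pow_mul] at e4
  set c := algebraMap (ZMod p) K ((polylogPoly p 1 ^ 3).coeff p)
  set f := φ ^ p
  set A := aeval φ (polylogPoly p 3)
  set B := aeval (-φ) (polylogPoly p 3)
  set D := aeval (φ ^ 2) (polylogPoly p 3)
  set L := aeval φ (polylogPoly p 1)
  set U := aeval (1 - φ) (polylogPoly p 3)
  set W := aeval (1 - (φ - 1)) (polylogPoly p 3)
  have hg : f * (f - 1) = 1 := by linear_combination hf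
  have hU : U = (f - 1) * B := by linear_combination -(f - 1) * e3 - U * hg
  have hW : f ^ 2 * W = -D := by linear_combination e4
  have r1 : 6 * (f * A - (f - 1) ^ 2 * B + (f - 1) * D) = L ^ 3 + c := by
    rw [hU] at e1
    linear_combination e1 + 6 * (f - 1) * hW + c * hg
  -- Landen and distribution involve `A` and `B` only through the same combination, so eliminating
  -- it isolates `D`.
  have r3 : (f - 1) * D = 4 * (f * A - (f - 1) ^ 2 * B) := by
    linear_combination (f - 1) * e5 + 4 * A * f * hg - 4 * A * (f - 1) * hf
  have r4 : 15 * ((f - 1) * D) = 2 * (L ^ 3 + c) := by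
    linear_combination 2 * r1 + 3 * r3
  linear_combination f * r4 - 15 * D * hg

end Golden

/-! ### Reduction of `p`-integral reals modulo `p`, and the quotient `Q_p`. -/

section Reduction

/-- The ring of `p`-integral real numbers. -/
def pIntegralSubring (p : ℕ) [hp : Fact p.Prime] : Subring ℝ where
  carrier := {z | IsPIntegral p z}
  mul_mem' := by
    rintro x y ⟨m, hm, hx⟩ ⟨n, hn, hy⟩
    refine ⟨m * n, (Nat.prime_iff_prime_int.1 hp.out).not_dvd_mul hm hn, ?_⟩
    have e : ((m * n : ℤ) : ℝ) * (x * y) = m * x * (n * y) := by push_cast; ring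
    rw [e]
    exact hx.mul hy
  one_mem' := ⟨1, (Nat.prime_iff_prime_int.1 hp.out).not_dvd_one, by simpa using isIntegral_one⟩
  add_mem' := by
    rintro x y ⟨m, hm, hx⟩ ⟨n, hn, hy⟩
    refine ⟨m * n, (Nat.prime_iff_prime_int.1 hp.out).not_dvd_mul hm hn, ?_⟩
    have e : ((m * n : ℤ) : ℝ) * (x + y) = n • (m * x) + m • (n * y) := by
      simp only [zsmul_eq_mul]; push_cast; ring
    rw [e]
    exact (hx.smul n).add (hy.smul m)
  zero_mem' := ⟨1, (Nat.prime_iff_prime_int.1 hp.out).not_dvd_one, by simpa using isIntegral_zero⟩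
  neg_mem' := by
    rintro x ⟨m, hm, hx⟩
    exact ⟨m, hm, by simpa using hx.neg⟩

variable (p : ℕ) [hp : Fact p.Prime]

/-- The ring of `p`-integral real numbers modulo `p`. -/
abbrev ResidueRing : Type :=
  pIntegralSubring p ⧸ Ideal.span {((p : ℕ) : pIntegralSubring p)}

lemma not_isPIntegral_inv : ¬ IsPIntegral p ((p : ℝ)⁻¹) := by
  rintro ⟨n, hn, h⟩
  have hp0 : (p : ℝ) ≠ 0 := Nat.cast_ne_zero.2 hp.out.ne_zero
  have h' : IsIntegral ℤ (algebraMap ℚ ℝ ((n : ℚ) * (p : ℚ)⁻¹)) := by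
    convert h using 1
    simp
  rw [isIntegral_algebraMap_iff (algebraMap ℚ ℝ).injective] at h'
  obtain ⟨m, hm⟩ := IsIntegrallyClosed.isIntegral_iff.1 h'
  refine hn ⟨m, ?_⟩
  have hp0' : (p : ℚ) ≠ 0 := Nat.cast_ne_zero.2 hp.out.ne_zero
  rw [algebraMap_int_eq, eq_intCast, eq_mul_inv_iff_mul_eq₀ hp0'] at hm
  have : m * (p : ℤ) = n := by exact_mod_cast hm
  rw [← this, mul_comm]

instance : CharP (ResidueRing p) p := by
  have hp0 : (p : ℝ) ≠ 0 := Nat.cast_ne_zero.2 hp.out.ne_zero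
  have hnt : Nontrivial (ResidueRing p) := by
    refine Ideal.Quotient.nontrivial_iff.2 fun h => ?_
    rw [Ideal.eq_top_iff_one, Ideal.mem_span_singleton'] at h
    obtain ⟨a, ha⟩ := h
    have ha' := congrArg (Subtype.val) ha
    refine not_isPIntegral_inv p ?_
    have : (a : ℝ) = (p : ℝ)⁻¹ := by
      refine eq_inv_of_mul_eq_one_left ?_
      simpa using ha'
    rw [← this]
    exact a.2
  have hz : ((p : ℕ) : ResidueRing p) = 0 := by
    rw [← map_natCast (Ideal.Quotient.mk _), Ideal.Quotient.eq_zero_iff_mem]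
    exact Ideal.mem_span_singleton_self _
  obtain ⟨q, hq⟩ := CharP.exists (ResidueRing p)
  -- The characteristic divides `p`, and it is not `1` because the quotient is nontrivial: `1/p` is
  -- not `p`-integral.
  rcases (Nat.dvd_prime hp.out).1 ((CharP.cast_eq_zero_iff _ q p).1 hz) with rfl | rfl
  · exact absurd rfl (CharP.char_ne_one (ResidueRing p) 1)
  · exact hq

noncomputable instance : Algebra (ZMod p) (ResidueRing p) := ZMod.algebra _ p

variable {p}

/-- `x` is `p`-integral with residue `a` modulo `p`. -/
def ReducesTo (x : ℝ) (a : ResidueRing p) : Prop :=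
  ∃ r : pIntegralSubring p, (r : ℝ) = x ∧ Ideal.Quotient.mk _ r = a

namespace ReducesTo

variable {x y : ℝ} {a b : ResidueRing p}

lemma unique (hx : ReducesTo x a) (hy : ReducesTo x b) : a = b := by
  obtain ⟨r, hr, rfl⟩ := hx
  obtain ⟨s, hs, rfl⟩ := hy
  rw [Subtype.ext (hr.trans hs.symm)]

lemma modEqP (hx : ReducesTo x a) (hy : ReducesTo y a) : ModEqP p x y := by
  obtain ⟨r, rfl, rfl⟩ := hx
  obtain ⟨s, rfl, hs⟩ := hy
  rw [eq_comm, Ideal.Quotient.eq, Ideal.mem_span_singleton'] at hs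
  obtain ⟨c, hc⟩ := hs
  refine ⟨c, c.2, ?_⟩
  have := congrArg Subtype.val hc
  push_cast at this
  rw [← this, mul_comm]

lemma add (hx : ReducesTo x a) (hy : ReducesTo y b) : ReducesTo (x + y) (a + b) := by
  obtain ⟨r, rfl, rfl⟩ := hx
  obtain ⟨s, rfl, rfl⟩ := hy
  exact ⟨r + s, by push_cast; rfl, map_add _ _ _⟩

lemma neg (hx : ReducesTo x a) : ReducesTo (-x) (-a) := by
  obtain ⟨r, rfl, rfl⟩ := hx
  exact ⟨-r, by push_cast; rfl, map_neg _ _⟩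

lemma sub (hx : ReducesTo x a) (hy : ReducesTo y b) : ReducesTo (x - y) (a - b) := by
  rw [sub_eq_add_neg, sub_eq_add_neg]
  exact hx.add hy.neg

lemma mul (hx : ReducesTo x a) (hy : ReducesTo y b) : ReducesTo (x * y) (a * b) := by
  obtain ⟨r, rfl, rfl⟩ := hx
  obtain ⟨s, rfl, rfl⟩ := hy
  exact ⟨r * s, by push_cast; rfl, map_mul _ _ _⟩

lemma pow (hx : ReducesTo x a) (n : ℕ) : ReducesTo (x ^ n) (a ^ n) := by
  obtain ⟨r, rfl, rfl⟩ := hx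
  exact ⟨r ^ n, by push_cast; rfl, map_pow _ _ _⟩

lemma intCast (n : ℤ) : ReducesTo (n : ℝ) (n : ResidueRing p) :=
  ⟨n, by push_cast; rfl, map_intCast _ _⟩

lemma natCast (n : ℕ) : ReducesTo (n : ℝ) (n : ResidueRing p) :=
  ⟨n, by push_cast; rfl, map_natCast _ _⟩

lemma sum {ι : Type*} {s : Finset ι} {f : ι → ℝ} {g : ι → ResidueRing p}
    (h : ∀ i ∈ s, ReducesTo (f i) (g i)) : ReducesTo (∑ i ∈ s, f i) (∑ i ∈ s, g i) := by
  classical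
  induction s using Finset.induction_on with
  | empty => simpa using natCast (p := p) 0
  | insert i s hi ih =>
    rw [Finset.sum_insert hi, Finset.sum_insert hi]
    exact (h i (Finset.mem_insert_self i s)).add
      (ih fun j hj => h j (Finset.mem_insert_of_mem hj))

lemma natCast_inv {n : ℕ} (hn : ¬ p ∣ n) :
    ReducesTo ((n : ℝ)⁻¹) (algebraMap (ZMod p) (ResidueRing p) (n : ZMod p)⁻¹) := by
  have hn0 : (n : ℝ) ≠ 0 := Nat.cast_ne_zero.2 fun h => hn (h ▸ dvd_zero p)
  have hn1 : (n : ZMod p) ≠ 0 := by rwa [Ne, ZMod.natCast_eq_zero_iff]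
  have hmem : IsPIntegral p (n : ℝ)⁻¹ := by
    refine ⟨n, by exact_mod_cast hn, ?_⟩
    rw [Int.cast_natCast, mul_inv_cancel₀ hn0]
    exact isIntegral_one
  have h : ReducesTo ((n : ℝ)⁻¹) (Ideal.Quotient.mk _ (⟨_, hmem⟩ : pIntegralSubring p)) :=
    ⟨_, rfl, rfl⟩
  convert h
  set c : ResidueRing p := Ideal.Quotient.mk _ (⟨_, hmem⟩ : pIntegralSubring p)
  have h1 : (n : ResidueRing p) * c = 1 := by
    refine ((natCast n).mul h).unique ?_
    rw [mul_inv_cancel₀ hn0]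
    simpa using natCast (p := p) 1
  have h2 : algebraMap (ZMod p) (ResidueRing p) (n : ZMod p)⁻¹ * (n : ResidueRing p) = 1 := by
    rw [← map_natCast (algebraMap (ZMod p) (ResidueRing p)), ← map_mul, inv_mul_cancel₀ hn1, map_one]
  linear_combination -(algebraMap (ZMod p) (ResidueRing p) (n : ZMod p)⁻¹) * h1 + c * h2

lemma of_natCast_mul {n : ℕ} (hn : ¬ p ∣ n) (h : ReducesTo ((n : ℝ) * x) a) :
    ∃ b, ReducesTo (p := p) x b := by
  have hn0 : (n : ℝ) ≠ 0 := Nat.cast_ne_zero.2 fun h => hn (h ▸ dvd_zero p)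
  have h' := (natCast_inv hn).mul h
  rw [inv_mul_cancel_left₀ hn0] at h'
  exact ⟨_, h'⟩

lemma finPolylog (d : ℕ) (hx : ReducesTo x a) :
    ReducesTo (finPolylog p d x) (aeval a (polylogPoly p d)) := by
  rw [aeval_polylogPoly, FinitePolylog.finPolylog]
  refine sum fun k hk => ?_
  have hk0 : ¬ p ∣ k := by
    rw [← ZMod.natCast_eq_zero_iff]; exact natCast_ne_zero_of_mem_Icc hk
  rw [div_eq_mul_inv, mul_comm, ← inv_pow, map_pow]
  exact ((natCast_inv hk0).pow d).mul (hx.pow k)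

end ReducesTo

/-- By Pascal's rule, neighbouring entries of row `p - 1` add up to an inner entry of row `p`, which
is divisible by `p`. -/
lemma natCast_choose_pred {j : ℕ} (hj : j < p) : (((p - 1).choose j : ℕ) : ZMod p) = (-1) ^ j := by
  induction j with
  | zero => simp
  | succ j ih =>
    have h := Nat.choose_succ_succ (p - 1) j
    rw [Nat.succ_eq_add_one, Nat.succ_eq_add_one, Nat.sub_add_cancel hp.out.one_le] at h
    have h0 : ((p.choose (j + 1) : ℕ) : ZMod p) = 0 := by
      rw [ZMod.natCast_eq_zero_iff]
      exact hp.out.dvd_choose_self (Nat.succ_ne_zero j) hj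
    rw [h, Nat.cast_add, ih (by omega)] at h0
    rw [pow_succ]
    linear_combination h0

/-- From `k · C(p,k) = p · C(p-1,k-1)` and `C(p-1,k-1) ≡ (-1)^(k-1)`. -/
lemma natCast_choose_div {k : ℕ} (hk : k ∈ Finset.Icc 1 (p - 1)) :
    ((p.choose k / p : ℕ) : ZMod p) * (-1) ^ k = -(k : ZMod p)⁻¹ := by
  have hk0 := natCast_ne_zero_of_mem_Icc hk
  rw [Finset.mem_Icc] at hk
  obtain ⟨j, rfl⟩ : ∃ j, k = j + 1 := ⟨k - 1, by omega⟩
  obtain ⟨N, hN⟩ := hp.out.dvd_choose_self (Nat.succ_ne_zero j) (by omega)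
  rw [Nat.succ_eq_add_one] at hN
  have h := Nat.add_one_mul_choose_eq (p - 1) j
  rw [Nat.sub_add_cancel hp.out.one_le, hN, mul_assoc] at h
  have h' := congrArg (fun n : ℕ => (n : ZMod p)) (Nat.eq_of_mul_eq_mul_left hp.out.pos h)
  simp only [Nat.cast_mul] at h'
  rw [natCast_choose_pred (by omega)] at h'
  rw [hN, Nat.mul_div_cancel_left _ hp.out.pos]
  have hs : (-1 : ZMod p) ^ j * (-1) ^ j = 1 := by rw [← mul_pow]; simp
  refine mul_right_cancel₀ hk0 ?_
  rw [neg_mul, inv_mul_cancel₀ hk0, pow_succ]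
  linear_combination (-1) ^ j * h' - hs

lemma bigQ_eq_sum (hp2 : 2 < p) (x : ℝ) :
    bigQ p x = ∑ k ∈ Finset.Icc 1 (p - 1), ((p.choose k / p : ℕ) : ℝ) * (-x) ^ k := by
  have hp0 : (p : ℝ) ≠ 0 := Nat.cast_ne_zero.2 hp.out.ne_zero
  have hodd : Odd p := hp.out.odd_of_ne_two (by omega)
  have hI : Finset.Ico (0 + 1) p = Finset.Icc 1 (p - 1) := by
    ext k; simp only [Finset.mem_Ico, Finset.mem_Icc]; omega
  have h : (1 - x) ^ p = 1 - x ^ p + ∑ k ∈ Finset.Icc 1 (p - 1), (p.choose k : ℝ) * (-x) ^ k := by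
    rw [show 1 - x = -x + 1 by ring, add_pow, Finset.sum_range_succ, Finset.range_eq_Ico,
      Finset.sum_eq_sum_Ico_succ_bot hp.out.pos, hI, hodd.neg_pow]
    simp only [one_pow, mul_one, pow_zero, Nat.choose_zero_right, Nat.choose_self, Nat.cast_one,
      mul_comm]
    ring
  rw [bigQ, h, div_eq_iff hp0, Finset.sum_mul]
  have h2 : x ^ p + (1 - x ^ p + ∑ k ∈ Finset.Icc 1 (p - 1), (p.choose k : ℝ) * (-x) ^ k) - 1 =
    ∑ k ∈ Finset.Icc 1 (p - 1), (p.choose k : ℝ) * (-x) ^ k := by ring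
  rw [h2]
  refine Finset.sum_congr rfl fun k hk => ?_
  rw [Finset.mem_Icc] at hk
  have hd := Nat.div_mul_cancel (hp.out.dvd_choose_self (k := k) (by omega) (by omega))
  rw [mul_right_comm, ← Nat.cast_mul, hd]

/-- Expanding `(1 - x)^p` binomially, the outer terms cancel for odd `p`, and `C(p,k)/p · (-1)^k ≡
-1/k` turns the rest into `-£_1`. -/
lemma ReducesTo.bigQ (hp2 : 2 < p) {x : ℝ} {a : ResidueRing p} (hx : ReducesTo x a) :
    ReducesTo (bigQ p x) (-aeval a (polylogPoly p 1)) := by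
  rw [bigQ_eq_sum hp2, aeval_polylogPoly, ← Finset.sum_neg_distrib]
  refine ReducesTo.sum fun k hk => ?_
  have h := (ReducesTo.natCast (p := p) (p.choose k / p)).mul (hx.neg.pow k)
  convert h using 1
  have h1 := congrArg (algebraMap (ZMod p) (ResidueRing p)) (natCast_choose_div hk)
  rw [map_mul, map_natCast, map_pow, map_neg, map_neg, map_one] at h1
  rw [pow_one, ← neg_mul, ← h1, neg_pow a]
  ring

end Reduction

/-! ### The harmonic sum and the Bernoulli number `B_{p-3}`. -/

section Bernoulli

variable {p : ℕ} [hp : Fact p.Prime]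

/-- In the Bernoulli recursion `B_i` carries the coefficient `i + 1 < p`, which is invertible modulo
`p`, so integrality follows by induction. -/
lemma exists_reducesTo_bernoulli {i : ℕ} (hi : i < p - 1) :
    ∃ b, ReducesTo (p := p) ((bernoulli i : ℚ) : ℝ) b := by
  induction i using Nat.strong_induction_on with
  | _ i ih =>
    have h := _root_.sum_bernoulli (i + 1)
    rw [Finset.sum_range_succ, Nat.choose_succ_self_right] at h
    have hS : ∃ c, ReducesTo (p := p)
        (∑ k ∈ Finset.range i, ((i + 1).choose k : ℝ) * ((bernoulli k : ℚ) : ℝ)) c := by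
      choose! b hb using ih
      exact ⟨_, ReducesTo.sum fun k hk => (ReducesTo.natCast _).mul
        (hb k (Finset.mem_range.1 hk) (by rw [Finset.mem_range] at hk; omega))⟩
    obtain ⟨c, hc⟩ := hS
    have hone : ∃ d, ReducesTo (p := p) (((if i + 1 = 1 then 1 else 0 : ℚ) : ℚ) : ℝ) d := by
      split_ifs
      · exact ⟨_, by simpa using ReducesTo.natCast (p := p) 1⟩
      · exact ⟨_, by simpa using ReducesTo.natCast (p := p) 0⟩
    obtain ⟨d, hd⟩ := hone
    refine ReducesTo.of_natCast_mul (n := i + 1) (fun hdvd => ?_) (a := d - c) ?_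
    · have := Nat.le_of_dvd (Nat.succ_pos i) hdvd
      omega
    · convert hd.sub hc using 1
      rw [← h]
      push_cast
      ring

/-- The multiple harmonic sum `∑ H_{n-1} / n ^ 2` modulo `p`. -/
lemma reducesTo_bernoulli (hp3 : 3 < p) :
    ReducesTo ((bernoulli (p - 3) : ℚ) : ℝ) (algebraMap (ZMod p) (ResidueRing p)
      (∑ n ∈ Finset.Icc 1 (p - 1), (n : ZMod p)⁻¹ ^ 2 * ∑ j ∈ Finset.range n, (j : ZMod p)⁻¹)) := by
  have hex : ∀ i, ∃ b, i < p - 1 → ReducesTo (p := p) ((bernoulli i : ℚ) : ℝ) b := fun i => by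
    by_cases hi : i < p - 1
    · obtain ⟨b, hb⟩ := exists_reducesTo_bernoulli hi
      exact ⟨b, fun _ => hb⟩
    · exact ⟨0, fun h => absurd h hi⟩
  choose b hb using hex
  have hinv (j : ℕ) : (j : ZMod p)⁻¹ = (j : ZMod p) ^ (p - 2) := by
    by_cases hj : (j : ZMod p) = 0
    · rw [hj, inv_zero, zero_pow (by omega)]
    · refine inv_eq_of_mul_eq_one_right ?_
      rw [← pow_succ', show p - 2 + 1 = p - 1 by omega,
        ZMod.pow_card_sub_one_eq_one hj]
  -- Faulhaber's formula for exponent `p - 2`, multiplied by `p - 1 ≡ -1`; all Bernoulli numbers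
  -- involved have index below `p - 1`.
  have hfaul (n : ℕ) : -∑ j ∈ Finset.range n, (j : ResidueRing p) ^ (p - 2) =
      ∑ i ∈ Finset.range (p - 1), b i * ((p - 1).choose i : ℕ) * (n : ResidueRing p) ^ (p - 1 - i) := by
    have h := congrArg (fun q : ℚ => (q : ℝ)) (sum_range_pow n (p - 2))
    have hR : ((p : ℝ) - 1) * ∑ j ∈ Finset.range n, (j : ℝ) ^ (p - 2) =
        ∑ i ∈ Finset.range (p - 1), ((bernoulli i : ℚ) : ℝ) * ((p - 1).choose i : ℕ) *
          (n : ℝ) ^ (p - 1 - i) := by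
      have hp1 : ((p - 2 : ℕ) : ℝ) + 1 = (p : ℝ) - 1 := by
        rw [Nat.cast_sub (by omega)]; push_cast; ring
      have hp1' : (p : ℝ) - 1 ≠ 0 := by
        have : (3 : ℝ) < p := by exact_mod_cast hp3
        linarith
      push_cast at h
      rw [h, Finset.mul_sum]
      rw [show p - 2 + 1 = p - 1 by omega]
      refine Finset.sum_congr rfl fun i _ => ?_
      rw [hp1]
      field_simp
    have hL := ((ReducesTo.natCast (p := p) p).sub (ReducesTo.natCast (p := p) 1)).mul
      (ReducesTo.sum (p := p) (s := Finset.range n) fun j _ => (ReducesTo.natCast j).pow (p - 2))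
    rw [Nat.cast_one, Nat.cast_one, hR, CharP.cast_eq_zero (ResidueRing p) p, zero_sub, neg_one_mul] at hL
    refine hL.unique (ReducesTo.sum fun i hi => ?_)
    exact ((hb i (Finset.mem_range.1 hi)).mul (ReducesTo.natCast _)).mul
      ((ReducesTo.natCast n).pow _)
  convert hb (p - 3) (by omega) using 1
  rw [← neg_inj, map_sum, ← Finset.sum_neg_distrib]
  have hterm (n) (hn : n ∈ Finset.Icc 1 (p - 1)) :
      -algebraMap (ZMod p) (ResidueRing p)
        ((n : ZMod p)⁻¹ ^ 2 * ∑ j ∈ Finset.range n, (j : ZMod p)⁻¹) =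
      ∑ i ∈ Finset.range (p - 1), b i * ((p - 1).choose i : ℕ) *
        (n : ResidueRing p) ^ (2 * p - 4 - i) := by
    have hn0 := natCast_ne_zero_of_mem_Icc hn
    have h1 : (n : ZMod p)⁻¹ ^ 2 = (n : ZMod p) ^ (p - 3) := by
      rw [inv_pow]
      refine inv_eq_of_mul_eq_one_right ?_
      rw [← pow_add,
        show 2 + (p - 3) = p - 1 by omega, ZMod.pow_card_sub_one_eq_one hn0]
    rw [h1]
    simp only [hinv]
    rw [map_mul, ← mul_neg, map_sum]
    simp only [map_pow, map_natCast]
    rw [hfaul, Finset.mul_sum]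
    refine Finset.sum_congr rfl fun i hi => ?_
    rw [Finset.mem_range] at hi
    rw [show 2 * p - 4 - i = (p - 3) + (p - 1 - i) by omega, pow_add]
    ring
  rw [Finset.sum_congr rfl hterm, Finset.sum_comm]
  -- The exponent `2p - 4 - i` runs from `p - 2` to `2p - 4`, where `p - 1` is the only multiple of
  -- `p - 1`; so only `i = p - 3` survives.
  have hpow (i) (hi : i ∈ Finset.range (p - 1)) :
      ∑ n ∈ Finset.Icc 1 (p - 1), b i * ((p - 1).choose i : ℕ) *
        (n : ResidueRing p) ^ (2 * p - 4 - i) =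
      if i = p - 3 then -b i * ((p - 1).choose i : ℕ) else 0 := by
    rw [Finset.mem_range] at hi
    have h := congrArg (algebraMap (ZMod p) (ResidueRing p))
      (sum_natCast_pow (p := p) (2 * p - 4 - i))
    rw [map_sum] at h
    simp only [map_pow, map_natCast] at h
    rw [← Finset.mul_sum, h]
    by_cases hi3 : i = p - 3
    · rw [if_pos hi3, if_pos ⟨1, by omega⟩, map_neg, map_one]
      ring
    · rw [if_neg hi3, if_neg, map_zero, mul_zero]
      rintro ⟨c, hc⟩
      rcases Nat.lt_or_ge c 2 with h2 | h2
      · interval_cases c <;> omega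
      · have := Nat.mul_le_mul_left (p - 1) h2
        omega
  rw [Finset.sum_congr rfl hpow, Finset.sum_ite_eq' , if_pos (Finset.mem_range.2 (by omega))]
  have hch := congrArg (algebraMap (ZMod p) (ResidueRing p))
    (natCast_choose_pred (p := p) (j := p - 3) (by omega))
  have hodd : Odd p := hp.out.odd_of_ne_two (by omega)
  have heven : Even (p - 3) := by
    obtain ⟨m, hm⟩ := hodd
    exact ⟨m - 1, by omega⟩
  rw [map_natCast, heven.neg_one_pow, map_one] at hch
  rw [hch, mul_one]

end Bernoulli

/-! ### The golden ratio modulo `p`: Lucas quotient and Frobenius. -/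

section Main

lemma phi_sq {ε : ℝ} (hε : ε = 1 ∨ ε = -1) : phi ε ^ 2 = phi ε + 1 := by
  have h5 : √5 ^ 2 = (5 : ℝ) := Real.sq_sqrt (by norm_num)
  have he : ε ^ 2 = 1 := by rcases hε with rfl | rfl <;> norm_num
  rw [phi]
  linear_combination ε ^ 2 / 4 * h5 + 5 / 4 * he

lemma lucasNumber_eq {x : ℝ} (hx : x ^ 2 = x + 1) (n : ℕ) :
    (lucasNumber n : ℝ) = x ^ n + (1 - x) ^ n := by
  induction n using Nat.twoStepInduction with
  | zero => norm_num [lucasNumber]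
  | one => simp [lucasNumber]
  | more n h0 h1 =>
    rw [lucasNumber, Int.cast_add, h0, h1, pow_add x n 2, pow_add (1 - x) n 2]
    linear_combination -(x ^ n + (1 - x) ^ n) * hx

lemma bigQ_phi (p : ℕ) {ε : ℝ} (hε : ε = 1 ∨ ε = -1) : bigQ p (phi ε) = lucasQuotient p := by
  rw [bigQ, lucasQuotient, lucasNumber_eq (phi_sq hε)]

variable {p : ℕ} [hp : Fact p.Prime]

lemma exists_reducesTo_sqrt_five : ∃ s, ReducesTo (p := p) √5 s := by
  refine ⟨_, ⟨√5, 1, (Nat.prime_iff_prime_int.1 hp.out).not_dvd_one, ?_⟩, rfl, rfl⟩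
  rw [Int.cast_one, one_mul]
  refine IsIntegral.of_pow (n := 2) two_pos ?_
  rw [Real.sq_sqrt (by norm_num)]
  exact_mod_cast isIntegral_algebraMap (R := ℤ) (A := ℝ) (x := 5)

lemma natCast_mul_algebraMap_inv {n : ℕ} (hn : ¬ p ∣ n) :
    (n : ResidueRing p) * algebraMap (ZMod p) (ResidueRing p) (n : ZMod p)⁻¹ = 1 := by
  rw [← map_natCast (algebraMap (ZMod p) (ResidueRing p)), ← map_mul, mul_inv_cancel₀, map_one]
  rwa [Ne, ZMod.natCast_eq_zero_iff]

/-- Since `5 ≡ 1` modulo `4`, reciprocity replaces `(p/5)` by `(5/p)`, to which Euler's criterion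
applies. -/
lemma legendreSym_five_pow (hp2 : p ≠ 2) :
    ((legendreSym 5 (p : ℤ) : ℤ) : ResidueRing p) = 5 ^ (p / 2) := by
  have h := legendreSym.eq_pow p 5
  rw [← legendreSym.quadratic_reciprocity_one_mod_four (p := 5) (q := p) (by norm_num) hp2]
  have h' := congrArg (algebraMap (ZMod p) (ResidueRing p)) h
  rw [map_intCast, map_pow, map_intCast] at h'
  exact_mod_cast h'

/-- The residue of `φ_ε`, together with that of `ε √5` and the action of Frobenius. -/
lemma exists_reducesTo_phi (hp2 : 2 < p) {ε : ℝ} (hε : ε = 1 ∨ ε = -1) :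
    ∃ a σ : ResidueRing p, ReducesTo (phi ε) a ∧ ReducesTo (ε * √5) σ ∧ a ^ 2 = a + 1 ∧
      2 * a ^ p = 1 + σ * ((legendreSym 5 (p : ℤ) : ℤ) : ResidueRing p) := by
  obtain ⟨s, hs⟩ := exists_reducesTo_sqrt_five (p := p)
  have he : ∃ e, ReducesTo (p := p) ε e := by
    rcases hε with rfl | rfl
    · exact ⟨_, by simpa using ReducesTo.intCast (p := p) 1⟩
    · exact ⟨_, by simpa using ReducesTo.intCast (p := p) (-1)⟩
  obtain ⟨e, he⟩ := he
  have hσ := he.mul hs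
  set σ := e * s
  have h2 : ¬ p ∣ 2 := fun h => absurd (Nat.le_of_dvd two_pos h) (by omega)
  have hone : ReducesTo (p := p) 1 1 := by simpa using ReducesTo.natCast (p := p) 1
  have htwo : ReducesTo (p := p) 2 2 := by simpa using ReducesTo.natCast (p := p) 2
  have ha := (hone.add hσ).mul (ReducesTo.natCast_inv h2)
  rw [Nat.cast_ofNat, ← div_eq_mul_inv] at ha
  change ReducesTo (phi ε) _ at ha
  set a := (1 + σ) * algebraMap (ZMod p) (ResidueRing p) ((2 : ℕ) : ZMod p)⁻¹
  have ha2 : a ^ 2 = a + 1 := by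
    refine (ha.pow 2).unique ?_
    rw [phi_sq hε]
    exact ha.add hone
  have h2a : 2 * a = 1 + σ := by
    refine (htwo.mul ha).unique ?_
    have : 2 * phi ε = 1 + ε * √5 := by rw [phi]; ring
    rw [this]
    exact hone.add hσ
  have hσ2 : σ ^ 2 = 5 := by
    refine (hσ.pow 2).unique ?_
    have : (ε * √5) ^ 2 = ((5 : ℕ) : ℝ) := by
      rw [mul_pow, Real.sq_sqrt (by norm_num)]
      rcases hε with rfl | rfl <;> norm_num
    rw [this]
    exact_mod_cast ReducesTo.natCast (p := p) 5
  refine ⟨a, σ, ha, hσ, ha2, ?_⟩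
  have hodd : Odd p := hp.out.odd_of_ne_two (by omega)
  have htp : (2 : ResidueRing p) ^ p = 2 := by
    have h := congrArg (algebraMap (ZMod p) (ResidueRing p)) (ZMod.pow_card (2 : ZMod p))
    rwa [map_pow, map_ofNat] at h
  -- As `p` is odd, `σ^p = σ (σ²)^((p-1)/2)`; with `2^p = 2` and additivity of Frobenius this
  -- determines `2 a^p`.
  have hσp : σ ^ p = σ * 5 ^ (p / 2) := by
    rw [← hσ2, ← pow_mul, ← pow_succ', Nat.two_mul_div_two_add_one_of_odd hodd]
  rw [legendreSym_five_pow (by omega), ← hσp, ← htp, ← mul_pow, h2a, add_pow_char, one_pow]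

end Main

end FinitePolylog

theorem mainTheorem4 (p : ℕ) (hp : p.Prime) (hp5 : 5 < p) (ε : ℝ) (hε : ε = 1 ∨ ε = -1) :
    FinitePolylog.bigQ p (FinitePolylog.phi ε) = FinitePolylog.lucasQuotient p ∧
    FinitePolylog.ModEqP p
      (FinitePolylog.finPolylog p 2 (FinitePolylog.phi ε))
      (-(ε * (√5 / 10) * FinitePolylog.leg5 p * FinitePolylog.lucasQuotient p ^ 2)) ∧
    FinitePolylog.ModEqP p
      (FinitePolylog.finPolylog p 2 (FinitePolylog.phi ε ^ 2))
      (-(1 / 2) * (1 + ε * (√5 / 5) * FinitePolylog.leg5 p)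
        * FinitePolylog.lucasQuotient p ^ 2) ∧
    FinitePolylog.ModEqP p
      (FinitePolylog.finPolylog p 2 (-FinitePolylog.phi ε))
      (-(1 / 4) * (1 + ε * (√5 / 5) * FinitePolylog.leg5 p)
        * FinitePolylog.lucasQuotient p ^ 2) ∧
    FinitePolylog.ModEqP p
      (FinitePolylog.finPolylog p 3 (FinitePolylog.phi ε ^ 2))
      (-(2 / 15) * (1 + ε * √5 * FinitePolylog.leg5 p)
        * (1 / 2 * FinitePolylog.lucasQuotient p ^ 3 + ((bernoulli (p - 3) : ℚ) : ℝ))) := by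
  have : Fact p.Prime := ⟨hp⟩
  obtain ⟨a, σ, ha, hσ, ha2, hf⟩ := FinitePolylog.exists_reducesTo_phi (p := p) (by omega) hε
  have hq := ha.bigQ (by omega)
  rw [FinitePolylog.bigQ_phi p hε] at hq
  have hB := FinitePolylog.reducesTo_bernoulli (p := p) (by omega)
  have hl : FinitePolylog.ReducesTo (FinitePolylog.leg5 p) _ :=
    FinitePolylog.ReducesTo.intCast (p := p) (legendreSym 5 (p : ℤ))
  obtain ⟨g1, g2, g3⟩ := FinitePolylog.aeval_polylogPoly_two_golden (by omega) ha2
  have g4 := FinitePolylog.aeval_polylogPoly_three_golden (by omega) ha2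
  rw [FinitePolylog.coeff_polylogPoly_one_cube, map_mul, map_neg, map_ofNat] at g4
  -- The denominators `10`, `15`, `20` factor into integers at most `5`, hence are prime to `p > 5`.
  have hndvd {m n : ℕ} (hm : m ∣ n) (h2 : ¬ p ∣ n / m) (h1 : m ≤ 5) (h0 : m ≠ 0) : ¬ p ∣ n := by
    intro h
    rw [← Nat.div_mul_cancel hm, hp.dvd_mul] at h
    exact h.elim h2 fun h => absurd (Nat.le_of_dvd (Nat.pos_of_ne_zero h0) h) (by omega)
  have hsmall {n : ℕ} (h1 : n ≤ 5) (h0 : n ≠ 0) : ¬ p ∣ n :=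
    fun h => absurd (Nat.le_of_dvd (Nat.pos_of_ne_zero h0) h) (by omega)
  have h10 : ¬ p ∣ 10 := hndvd (m := 2) (by norm_num) (hsmall (by norm_num) (by norm_num))
    (by norm_num) (by norm_num)
  have h15 : ¬ p ∣ 15 := hndvd (m := 3) (by norm_num) (hsmall (by norm_num) (by norm_num))
    (by norm_num) (by norm_num)
  have h20 : ¬ p ∣ 20 := hndvd (m := 4) (by norm_num) (hsmall (by norm_num) (by norm_num))
    (by norm_num) (by norm_num)
  have t10 := FinitePolylog.natCast_mul_algebraMap_inv h10
  have t15 := FinitePolylog.natCast_mul_algebraMap_inv h15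
  have t20 := FinitePolylog.natCast_mul_algebraMap_inv h20
  have r10 := FinitePolylog.ReducesTo.natCast_inv h10
  have r15 := FinitePolylog.ReducesTo.natCast_inv h15
  have r20 := FinitePolylog.ReducesTo.natCast_inv h20
  have hσl := hσ.mul hl
  have hone := FinitePolylog.ReducesTo.natCast (p := p) 1
  have htwo := FinitePolylog.ReducesTo.natCast (p := p) 2
  have hfive := FinitePolylog.ReducesTo.natCast (p := p) 5
  push_cast at t10 t15 t20 r10 r15 r20 hone htwo hfive
  refine ⟨FinitePolylog.bigQ_phi p hε, (ha.finPolylog 2).modEqP ?_,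
    ((ha.pow 2).finPolylog 2).modEqP ?_, (ha.neg.finPolylog 2).modEqP ?_,
    ((ha.pow 2).finPolylog 3).modEqP ?_⟩
  · convert ((r10.mul hσl).mul (hq.pow 2)).neg using 1
    · ring
    · set t := algebraMap (ZMod p) (FinitePolylog.ResidueRing p) (10 : ZMod p)⁻¹
      rw [neg_sq]
      linear_combination t * g1 - Polynomial.aeval a (FinitePolylog.polylogPoly p 2) * t10
        - t * Polynomial.aeval a (FinitePolylog.polylogPoly p 1) ^ 2 * hf
  · convert ((r10.mul (hfive.add hσl)).mul (hq.pow 2)).neg using 1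
    · ring
    · set t := algebraMap (ZMod p) (FinitePolylog.ResidueRing p) (10 : ZMod p)⁻¹
      rw [neg_sq]
      linear_combination t * g2 - Polynomial.aeval (a ^ 2) (FinitePolylog.polylogPoly p 2) * t10
        - t * Polynomial.aeval a (FinitePolylog.polylogPoly p 1) ^ 2 * hf
  · convert ((r20.mul (hfive.add hσl)).mul (hq.pow 2)).neg using 1
    · ring
    · set t := algebraMap (ZMod p) (FinitePolylog.ResidueRing p) (20 : ZMod p)⁻¹
      rw [neg_sq]
      linear_combination t * g3 - Polynomial.aeval (-a) (FinitePolylog.polylogPoly p 2) * t20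
        - t * Polynomial.aeval a (FinitePolylog.polylogPoly p 1) ^ 2 * hf
  · convert ((r15.mul (hone.add hσl)).mul ((hq.pow 3).add (htwo.mul hB))).neg using 1
    · ring
    · set t := algebraMap (ZMod p) (FinitePolylog.ResidueRing p) (15 : ZMod p)⁻¹
      set b := algebraMap (ZMod p) (FinitePolylog.ResidueRing p) (∑ n ∈ Finset.Icc 1 (p - 1),
        (n : ZMod p)⁻¹ ^ 2 * ∑ j ∈ Finset.range n, (j : ZMod p)⁻¹)
      linear_combination t * g4 -
        Polynomial.aeval (a ^ 2) (FinitePolylog.polylogPoly p 3) * t15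
        + t * (Polynomial.aeval a (FinitePolylog.polylogPoly p 1) ^ 3 - 2 * b) * hf
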